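/- Let $\mathbb{F}$ be a field, let $m,n\ge 1$ be integers, and let $\underline d=(d_1,\dots,d_m)$ be a list of nonnegative integers with $d:=\max_i d_i>0$. Let $M(\lambda)\in\mathbb{F}[\lambda]^{m\times(m+n)}$ be a polynomial matrix whose $i$th row has degree at most $d_i$ for $i=1,\dots,m$. Let $M_{\underline d}\in\mathbb{F}^{m\times(m+n)}$ be the matrix whose $i$th row is the vector coefficient of $\lambda^{d_i}$ in the $i$th row of $M(\lambda)$. Write $M(\lambda)=M_0+M_1\lambda+\cdots+M_d\lambda^d$. For $k\ge 1$, the $k$th Sylvester matrix $S_k$ is the $(k+d)m\times k(m+n)$ matrix with $k+d$ block rows and $k$ block columns whose block in position $(a,b)$ is $M_{a-b}$ if $0\le a-b\le d$ and $0$ otherwise. The $k$th trimmed Sylvester matrix $T_k\in\mathbb{F}^{(km+\sum_i d_i)\times k(m+n)}$ is obtained from $S_k$ by removing, for each $i=1,\dots,m$, the $i$th row of each of the last $d-d_i$ block rows (these rows are all zero). A minimal basis of a subspace $\mathcal V$ of $\mathbb{F}(\lambda)^{p}$ is a basis of $\mathcal V$ over $\mathbb{F}(\lambda)$ that consists of vectors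 with entries in $\mathbb{F}[\lambda]$ and whose sum of degrees is minimal among all such bases of $\mathcal V$ (the degree of a polynomial vector is the highest degree of its entries). The matrix $M(\lambda)$ is called a minimal basis if its rows form a minimal basis of the subspace of $\mathbb{F}(\lambda)^{m+n}$ that they span. The right minimal indices of $M(\lambda)$ are the degrees of the vectors of any minimal basis of the right null space $\{x\in\mathbb{F}(\lambda)^{m+n}: M(\lambda)x=0\}$. Then $M(\lambda)$ is a minimal basis with $\operatorname{rank}(M_{\underline d})=m$ if and only if there exists an index $k\ge 1$ such that $T_k$ has full row rank. In this case, if $d'$ is the smallest index $k\ge 1$ for which $T_k$ has full row rank, then $d'$ is the largest right minimal index of $M(\lambda)$, and all the matrices $T_k$ with $k>d'$ also have full row rank. -/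

import Mathlib

open scoped Polynomial

noncomputable section

namespace TrimmedSylvester

/-- The polynomial matrices whose `i`-th row has degree at most `d i`, for every `i`. -/
def RowDegreeBounded {F : Type*} [Field F] {m q : ℕ} (d : Fin m → ℕ) :
    Set (Matrix (Fin m) (Fin q) F[X]) :=
  {M | ∀ i j, (M i j).natDegree ≤ d i}

/-- The leading row-wise coefficient matrix with respect to `d`: its `i`-th row is the
vector coefficient of `X ^ d i` in the `i`-th row of `M` (it may vanish). -/
def leadingRowwiseCoeff {F : Type*} [Field F] {m q : ℕ} (d : Fin m → ℕ)
    (M : Matrix (Fin m) (Fin q) F[X]) : Matrix (Fin m) (Fin q) F :=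
  Matrix.of fun i j => (M i j).coeff (d i)

/-- The `k`-th Sylvester matrix of `M = M₀ + M₁ X + ⋯ + M_D X ^ D`: it has `k + D` block rows
and `k` block columns, and the block in position `(a, b)` is `M_{a - b}` if
`b ≤ a ≤ b + D` and `0` otherwise. -/
def sylvester {F : Type*} [Field F] {m q : ℕ} (D k : ℕ) (M : Matrix (Fin m) (Fin q) F[X]) :
    Matrix (Fin (k + D) × Fin m) (Fin k × Fin q) F :=
  Matrix.of fun r c =>
    if (c.1 : ℕ) ≤ (r.1 : ℕ) ∧ (r.1 : ℕ) ≤ (c.1 : ℕ) + D then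
      (M r.2 c.2).coeff ((r.1 : ℕ) - (c.1 : ℕ))
    else 0

/-- The rows of the `k`-th Sylvester matrix that are kept in the trimmed one: of the `k + D`
rows coming from row `i` of the polynomial matrix, where `D = max d`, the last `D - d i` are
removed, so that the first `k + d i` remain. -/
abbrev TrimmedRow {m : ℕ} (d : Fin m → ℕ) (k : ℕ) : Type :=
  {r : Fin (k + Finset.univ.sup d) × Fin m // (r.1 : ℕ) < k + d r.2}

/-- The `k`-th trimmed Sylvester matrix of `M` with respect to `d`. -/
def trimmedSylvester {F : Type*} [Field F] {m q : ℕ} (d : Fin m → ℕ) (k : ℕ)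
    (M : Matrix (Fin m) (Fin q) F[X]) : Matrix (TrimmedRow d k) (Fin k × Fin q) F :=
  (sylvester (Finset.univ.sup d) k M).submatrix Subtype.val id

/-- Full row rank: the rank equals the number of rows. -/
def FullRowRank {F : Type*} [Field F] {r c : Type*} [Fintype r] [Fintype c]
    (A : Matrix r c F) : Prop :=
  A.rank = Fintype.card r

/-- The degree of a polynomial vector: the highest degree of its entries. -/
def vecDegree {F : Type*} [Field F] {q : ℕ} (v : Fin q → F[X]) : ℕ :=
  Finset.univ.sup fun j => (v j).natDegree

/-- A polynomial vector regarded as a vector of rational functions. -/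
def toRatVec {F : Type*} [Field F] {q : ℕ} (v : Fin q → F[X]) : Fin q → RatFunc F :=
  fun j => algebraMap F[X] (RatFunc F) (v j)

/-- The polynomial vectors `b i` form a basis, over the field of rational functions, of the
rational subspace `V`. -/
def IsPolynomialBasis {F : Type*} [Field F] {q r : ℕ}
    (V : Submodule (RatFunc F) (Fin q → RatFunc F)) (b : Fin r → Fin q → F[X]) : Prop :=
  LinearIndependent (RatFunc F) (fun i => toRatVec (b i)) ∧
    Submodule.span (RatFunc F) (Set.range fun i => toRatVec (b i)) = V

/-- A minimal basis of the rational subspace `V`: a basis consisting of polynomial vectors whose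
sum of degrees is minimal among all such bases of `V`. (All bases of `V` have the same number
`r` of elements.) -/
def IsMinimalBasis {F : Type*} [Field F] {q r : ℕ}
    (V : Submodule (RatFunc F) (Fin q → RatFunc F)) (b : Fin r → Fin q → F[X]) : Prop :=
  IsPolynomialBasis V b ∧
    ∀ c : Fin r → Fin q → F[X], IsPolynomialBasis V c →
      ∑ i, vecDegree (b i) ≤ ∑ i, vecDegree (c i)

/-- The polynomial matrix `M` is a minimal basis: its rows form a minimal basis of the rational
subspace that they span. -/
def RowsMinimalBasis {F : Type*} [Field F] {m q : ℕ} (M : Matrix (Fin m) (Fin q) F[X]) : Prop :=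
  IsMinimalBasis (Submodule.span (RatFunc F) (Set.range fun i => toRatVec (M i))) (fun i => M i)

/-- The right null space of `M` over the field of rational functions. -/
def rightNullSpace {F : Type*} [Field F] {m q : ℕ} (M : Matrix (Fin m) (Fin q) F[X]) :
    Submodule (RatFunc F) (Fin q → RatFunc F) :=
  LinearMap.ker (M.map (algebraMap F[X] (RatFunc F))).mulVecLin

/-- `ε` is the list of the right minimal indices of `M`, with multiplicities: the list of the
degrees of the vectors of a minimal basis of the right null space of `M`. -/
def IsRightMinimalIndices {F : Type*} [Field F] {m q : ℕ} (M : Matrix (Fin m) (Fin q) F[X])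
    (ε : Multiset ℕ) : Prop :=
  ∃ (r : ℕ) (b : Fin r → Fin q → F[X]), IsMinimalBasis (rightNullSpace M) b ∧
    ε = Finset.univ.val.map fun i => vecDegree (b i)

end TrimmedSylvester

end

/-! Reading block columns as coefficients, `T_k` is the map `x ↦ M x` from vectors of degree `< k`
to vectors whose `i`-th entry has degree `< k + d i`; full row rank means surjectivity
(`SylvesterSurjective`). For `k ≥ 1`, hitting the top coefficients shows that the leading matrix `L`
is onto, and hitting the constant unit vectors shows that `M` is right invertible over `F[X]`.
Conversely, if both hold, `L` strips top coefficients until the `i`-th degree is at most `d i`, and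
a fixed polynomial right inverse solves the rest (`exists_sylvesterSurjective`). This meets
minimality through Forney's criterion: minimal bases are right invertible and row reduced, by
exchange arguments, while right invertibility with `L` onto forces minimality by the predictable
degree property. For the largest index, full rank at `k` bounds all right minimal indices by `k`:
top coefficients of higher degree null vectors are already top coefficients of null vectors of
degree `≤ k`. If instead all indices are `≤ k`, full rank descends from `k + 1` to `k` (`of_succ`),
so the least `k` is attained as an index. -/

open Matrix

namespace TrimmedSylvester

/-! ### Trimmed Sylvester matrices as multiplication maps -/

section Sylvester

variable {F : Type*} [Field F] {m q : ℕ}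

/-- Every polynomial vector `y` with `deg (y i) < k + d i` is of the form `M x` with
`deg x < k`. -/
def SylvesterSurjective (d : Fin m → ℕ) (k : ℕ) (M : Matrix (Fin m) (Fin q) F[X]) : Prop :=
  ∀ y : Fin m → F[X], (∀ i t, k + d i ≤ t → (y i).coeff t = 0) →
    ∃ x : Fin q → F[X], (∀ j t, k ≤ t → (x j).coeff t = 0) ∧ M *ᵥ x = y

theorem coeff_mulVec_eq_zero {d : Fin m → ℕ} {M : Matrix (Fin m) (Fin q) F[X]}
    (hM : M ∈ RowDegreeBounded d) {N : ℕ} {x : Fin q → F[X]}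
    (hx : ∀ j t, N ≤ t → (x j).coeff t = 0) (i : Fin m) {t : ℕ} (ht : N + d i ≤ t) :
    ((M *ᵥ x) i).coeff t = 0 := by
  simp only [mulVec, dotProduct, Polynomial.finsetSum_coeff]
  refine Finset.sum_eq_zero fun j _ => ?_
  rw [Polynomial.coeff_mul]
  refine Finset.sum_eq_zero fun p hp => ?_
  have hp := Finset.HasAntidiagonal.mem_antidiagonal.1 hp
  rcases le_or_gt N p.2 with h | h
  · rw [hx j _ h, mul_zero]
  · rw [Polynomial.coeff_eq_zero_of_natDegree_lt (lt_of_le_of_lt (hM i j) (by omega)), zero_mul]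

theorem coeff_mulVec_top {d : Fin m → ℕ} {M : Matrix (Fin m) (Fin q) F[X]}
    (hM : M ∈ RowDegreeBounded d) {N : ℕ} {x : Fin q → F[X]}
    (hx : ∀ j t, N < t → (x j).coeff t = 0) (i : Fin m) :
    ((M *ᵥ x) i).coeff (N + d i) =
      (leadingRowwiseCoeff d M *ᵥ fun j => (x j).coeff N) i := by
  simp only [mulVec, dotProduct, Polynomial.finsetSum_coeff]
  refine Finset.sum_congr rfl fun j _ => ?_
  rw [add_comm N, Polynomial.coeff_mul_add_eq_of_natDegree_le (hM i j)
    (Polynomial.natDegree_le_iff_coeff_eq_zero.2 (hx j))]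
  rfl

theorem rank_eq_card_iff_mulVec_surjective {K r c : Type*} [Field K] [Fintype r] [Fintype c]
    (A : Matrix r c K) : A.rank = Fintype.card r ↔ Function.Surjective A.mulVec := by
  rw [← coe_mulVecLin, ← LinearMap.range_eq_top]
  constructor
  · intro h
    apply Submodule.eq_top_of_finrank_eq
    rw [Module.finrank_fintype_fun_eq_card, ← h]
    rfl
  · intro h
    rw [Matrix.rank, h, finrank_top, Module.finrank_fintype_fun_eq_card]

/-- One Sylvester row against a coefficient vector is a convolution; the band cutoff only discards
coefficients of `f` beyond its degree. -/
theorem coeff_mul_eq_sum_fin {D k : ℕ} {f g : F[X]} (hf : f.natDegree ≤ D)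
    (hg : ∀ t, k ≤ t → g.coeff t = 0) (a : ℕ) :
    ∑ b : Fin k, (if (b : ℕ) ≤ a ∧ a ≤ b + D then f.coeff (a - b) else 0) * g.coeff b =
      (f * g).coeff a := by
  rw [mul_comm f, Polynomial.coeff_mul, Finset.Nat.sum_antidiagonal_eq_sum_range_succ
    (fun s t => g.coeff s * f.coeff t)]
  have h1 : ∀ b : ℕ, (if b ≤ a ∧ a ≤ b + D then f.coeff (a - b) else 0) * g.coeff b =
      if b ≤ a then g.coeff b * f.coeff (a - b) else 0 := by
    intro b
    by_cases h : b ≤ a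
    · by_cases h' : a ≤ b + D
      · rw [if_pos ⟨h, h'⟩, if_pos h, mul_comm]
      · rw [if_neg (fun H => h' H.2), if_pos h, zero_mul,
          Polynomial.coeff_eq_zero_of_natDegree_lt (p := f) (by omega), mul_zero]
    · rw [if_neg (fun H => h H.1), if_neg h, zero_mul]
  simp only [h1]
  rw [Fin.sum_univ_eq_sum_range (fun b => if b ≤ a then g.coeff b * f.coeff (a - b) else 0),
    ← Finset.sum_filter]
  refine Finset.sum_subset (fun b hb => ?_) fun b hb hb' => ?_
  · simp only [Finset.mem_filter, Finset.mem_range] at hb ⊢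
    omega
  · rw [hg, zero_mul]
    simp only [Finset.mem_filter, Finset.mem_range] at hb hb'
    omega

theorem trimmedSylvester_mulVec {d : Fin m → ℕ} {M : Matrix (Fin m) (Fin q) F[X]}
    (hM : M ∈ RowDegreeBounded d) {k : ℕ} {x : Fin q → F[X]}
    (hx : ∀ j t, k ≤ t → (x j).coeff t = 0) (r : TrimmedRow d k) :
    (trimmedSylvester d k M *ᵥ fun c : Fin k × Fin q => (x c.2).coeff c.1) r =
      ((M *ᵥ x) r.1.2).coeff r.1.1 := by
  simp only [mulVec, dotProduct, Polynomial.finsetSum_coeff, Fintype.sum_prod_type]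
  rw [Finset.sum_comm]
  exact Finset.sum_congr rfl fun j _ => coeff_mul_eq_sum_fin
    ((hM r.1.2 j).trans (Finset.le_sup (f := d) (Finset.mem_univ r.1.2))) (hx j) _

theorem coeff_sum_monomial {k : ℕ} (v : Fin k → F) (t : ℕ) :
    (∑ b : Fin k, Polynomial.monomial (b : ℕ) (v b)).coeff t =
      if h : t < k then v ⟨t, h⟩ else 0 := by
  simp only [Polynomial.finsetSum_coeff, Polynomial.coeff_monomial]
  split_ifs with h
  · rw [Finset.sum_eq_single ⟨t, h⟩]
    · simp
    · intro b _ hb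
      rw [if_neg]
      exact fun H => hb (Fin.ext H)
    · simp
  · refine Finset.sum_eq_zero fun b _ => if_neg ?_
    omega

theorem fullRowRank_trimmedSylvester_iff {d : Fin m → ℕ} {M : Matrix (Fin m) (Fin q) F[X]}
    (hM : M ∈ RowDegreeBounded d) (k : ℕ) :
    FullRowRank (trimmedSylvester d k M) ↔ SylvesterSurjective d k M := by
  rw [FullRowRank, rank_eq_card_iff_mulVec_surjective]
  constructor
  · intro h y hy
    obtain ⟨v, hv⟩ := h fun r => (y r.1.2).coeff r.1.1
    let x : Fin q → F[X] := fun j => ∑ b : Fin k, Polynomial.monomial (b : ℕ) (v (b, j))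
    have hx : ∀ j t, k ≤ t → (x j).coeff t = 0 := fun j t ht => by
      simp only [x, coeff_sum_monomial, dif_neg (not_lt.2 ht)]
    have hxv : (fun c : Fin k × Fin q => (x c.2).coeff c.1) = v := by
      ext c
      exact (coeff_sum_monomial (fun b => v (b, c.2)) _).trans (dif_pos c.1.2)
    refine ⟨x, hx, ?_⟩
    ext i t
    by_cases ht : t < k + d i
    · have hs := Finset.le_sup (f := d) (Finset.mem_univ i)
      have := trimmedSylvester_mulVec hM hx ⟨(⟨t, by omega⟩, i), ht⟩
      rw [hxv, hv] at this
      exact this.symm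
    · rw [coeff_mulVec_eq_zero hM hx i (not_lt.1 ht), hy i t (not_lt.1 ht)]
  · intro h w
    let y : Fin m → F[X] := fun i => ∑ b : Fin (k + d i), Polynomial.monomial (b : ℕ)
      (w ⟨(⟨b, by have := Finset.le_sup (f := d) (Finset.mem_univ i); omega⟩, i), b.2⟩)
    obtain ⟨x, hx, hxy⟩ := h y fun i t ht => by
      simp only [y, coeff_sum_monomial, dif_neg (not_lt.2 ht)]
    refine ⟨fun c => (x c.2).coeff c.1, ?_⟩
    ext r
    rw [trimmedSylvester_mulVec hM hx, hxy]
    simp only [y, coeff_sum_monomial, dif_pos r.2]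

/-! ### Surjectivity, the leading matrix and right invertibility -/

theorem SylvesterSurjective.leading {d : Fin m → ℕ} {M : Matrix (Fin m) (Fin q) F[X]}
    (hM : M ∈ RowDegreeBounded d) {k : ℕ} (hk : 1 ≤ k) (h : SylvesterSurjective d k M) :
    Function.Surjective (leadingRowwiseCoeff d M).mulVec := by
  -- After the shift, `k` is the top degree allowed for `x`, and `k + d i` the top degree allowed in
  -- row `i`.
  obtain ⟨k, rfl⟩ : ∃ l, k = l + 1 := ⟨k - 1, by omega⟩
  intro w
  obtain ⟨x, hx, hxy⟩ := h (fun i => Polynomial.monomial (k + d i) (w i)) fun i t ht =>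
    Polynomial.coeff_monomial_of_ne _ (by omega)
  refine ⟨fun j => (x j).coeff k, ?_⟩
  ext i
  rw [← coeff_mulVec_top hM (fun j t ht => hx j t ht), hxy, Polynomial.coeff_monomial_same]

theorem SylvesterSurjective.mulVec_surjective {d : Fin m → ℕ}
    {M : Matrix (Fin m) (Fin q) F[X]} {k : ℕ} (hk : 1 ≤ k) (h : SylvesterSurjective d k M) :
    Function.Surjective M.mulVec := by
  have h1 : ∀ i : Fin m, ∃ x : Fin q → F[X], M *ᵥ x = Pi.single i 1 := fun i => by
    obtain ⟨x, -, hx⟩ := h (Pi.single i 1) fun j t ht => by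
      rcases eq_or_ne j i with rfl | hj
      · rw [Pi.single_eq_same, Polynomial.coeff_one, if_neg (by omega)]
      · rw [Pi.single_eq_of_ne hj, Polynomial.coeff_zero]
    exact ⟨x, hx⟩
  choose x hx using h1
  intro y
  refine ⟨∑ i, y i • x i, ?_⟩
  rw [mulVec_sum]
  simp only [mulVec_smul, hx]
  exact (pi_eq_sum_univ' y).symm

/-- If the leading row-wise coefficient matrix has full row rank, then the top coefficients of `y`
can be removed by subtracting some `M z` with `z` a monomial vector. -/
theorem exists_monomial_reduction {d : Fin m → ℕ} {M : Matrix (Fin m) (Fin q) F[X]}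
    (hM : M ∈ RowDegreeBounded d)
    (hL : Function.Surjective (leadingRowwiseCoeff d M).mulVec) {k : ℕ} {y : Fin m → F[X]}
    (hy : ∀ i t, k + 1 + d i ≤ t → (y i).coeff t = 0) :
    ∃ z : Fin q → F[X], (∀ j t, k + 1 ≤ t → (z j).coeff t = 0) ∧
      ∀ i t, k + d i ≤ t → ((y - M *ᵥ z) i).coeff t = 0 := by
  obtain ⟨w, hw⟩ := hL fun i => (y i).coeff (k + d i)
  have hz : ∀ (j : Fin q) t, k + 1 ≤ t → (Polynomial.monomial k (w j)).coeff t = 0 :=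
    fun j t ht => Polynomial.coeff_monomial_of_ne _ (by omega)
  refine ⟨fun j => Polynomial.monomial k (w j), hz, fun i t ht => ?_⟩
  rw [Pi.sub_apply, Polynomial.coeff_sub]
  rcases ht.eq_or_lt with rfl | ht
  · rw [coeff_mulVec_top hM hz]
    simp only [Polynomial.coeff_monomial_same]
    rw [hw, sub_self]
  · rw [coeff_mulVec_eq_zero hM hz i (by omega), hy i t (by omega), sub_zero]

/-- One monomial correction brings the right-hand side within the degree bounds for `k`. -/
theorem SylvesterSurjective.succ {d : Fin m → ℕ} {M : Matrix (Fin m) (Fin q) F[X]}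
    (hM : M ∈ RowDegreeBounded d)
    (hL : Function.Surjective (leadingRowwiseCoeff d M).mulVec) {k : ℕ}
    (h : SylvesterSurjective d k M) : SylvesterSurjective d (k + 1) M := by
  intro y hy
  obtain ⟨z, hz, hyz⟩ := exists_monomial_reduction hM hL hy
  obtain ⟨x, hx, hxy⟩ := h _ hyz
  refine ⟨x + z, fun j t ht => ?_, ?_⟩
  · rw [Pi.add_apply, Polynomial.coeff_add, hx j t (by omega), hz j t ht, add_zero]
  · rw [mulVec_add, hxy, sub_add_cancel]

theorem SylvesterSurjective.mono {d : Fin m → ℕ} {M : Matrix (Fin m) (Fin q) F[X]}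
    (hM : M ∈ RowDegreeBounded d)
    (hL : Function.Surjective (leadingRowwiseCoeff d M).mulVec) {k l : ℕ} (hkl : k ≤ l)
    (h : SylvesterSurjective d k M) : SylvesterSurjective d l M :=
  Nat.le_induction h (fun _ _ ih => ih.succ hM hL) l hkl

theorem exists_sylvesterSurjective {d : Fin m → ℕ} {M : Matrix (Fin m) (Fin q) F[X]}
    (hM : M ∈ RowDegreeBounded d)
    (hL : Function.Surjective (leadingRowwiseCoeff d M).mulVec)
    (hS : Function.Surjective M.mulVec) : ∃ k, 1 ≤ k ∧ SylvesterSurjective d k M := by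
  choose e he using fun i : Fin m => hS (Pi.single i 1)
  -- Once the right-hand side satisfies `deg (y i) ≤ d i`, the solution `∑ i, y i • e i` has degree
  -- at most `D`.
  let D := (Finset.univ.sup d) + Finset.univ.sup fun i => Finset.univ.sup fun j => (e i j).natDegree
  refine ⟨D + 1, by omega, ?_⟩
  -- The bound on `x` stays at `D + 1` while the bound on `y` is lowered through `l`.
  suffices H : ∀ l, l ≤ D + 1 → ∀ y : Fin m → F[X],
      (∀ i t, l + d i ≤ t → (y i).coeff t = 0) →
      ∃ x : Fin q → F[X], (∀ j t, D + 1 ≤ t → (x j).coeff t = 0) ∧ M *ᵥ x = y from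
    H _ le_rfl
  intro l
  induction l with
  | zero =>
    intro _ y hy
    refine ⟨∑ i, y i • e i, fun j t ht => ?_, ?_⟩
    · simp only [Finset.sum_apply, Pi.smul_apply, smul_eq_mul, Polynomial.finsetSum_coeff]
      refine Finset.sum_eq_zero fun i _ => Polynomial.coeff_eq_zero_of_natDegree_lt ?_
      have h1 : (y i).natDegree ≤ d i :=
        Polynomial.natDegree_le_iff_coeff_eq_zero.2 fun s hs => hy i s (by omega)
      have h2 := Finset.le_sup (f := d) (Finset.mem_univ i)
      have h3 : (e i j).natDegree ≤
          Finset.univ.sup fun i => Finset.univ.sup fun j => (e i j).natDegree :=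
        (Finset.le_sup (f := fun j => (e i j).natDegree) (Finset.mem_univ j)).trans
          (Finset.le_sup (f := fun i => Finset.univ.sup fun j => (e i j).natDegree)
            (Finset.mem_univ i))
      have h4 := Polynomial.natDegree_mul_le (p := y i) (q := e i j)
      simp only [D] at ht
      omega
    · rw [mulVec_sum]
      simp only [mulVec_smul, he]
      exact (pi_eq_sum_univ' y).symm
  | succ l ih =>
    intro hl y hy
    obtain ⟨z, hz, hyz⟩ := exists_monomial_reduction hM hL hy
    obtain ⟨x, hx, hxy⟩ := ih (by omega) _ hyz
    refine ⟨x + z, fun j t ht => ?_, ?_⟩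
    · rw [Pi.add_apply, Polynomial.coeff_add, hx j t (by omega), hz j t (by omega), add_zero]
    · rw [mulVec_add, hxy, sub_add_cancel]

end Sylvester

/-! ### Minimal bases: predictable degrees, exchange, right invertibility -/

section MinimalBases

variable {F : Type*} [Field F] {q r : ℕ}

theorem natDegree_le_vecDegree (v : Fin q → F[X]) (j : Fin q) :
    (v j).natDegree ≤ vecDegree v :=
  Finset.le_sup (f := fun j => (v j).natDegree) (Finset.mem_univ j)

theorem vecDegree_le {v : Fin q → F[X]} {E : ℕ} (h : ∀ j, (v j).natDegree ≤ E) :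
    vecDegree v ≤ E :=
  Finset.sup_le fun j _ => h j

theorem vecDegree_lt_of_ne_zero {w : Fin q → F[X]} (hw : w ≠ 0) {E : ℕ}
    (h : ∀ j, w j ≠ 0 → (w j).natDegree < E) : vecDegree w < E := by
  obtain ⟨j, hj⟩ := Function.ne_iff.1 hw
  rw [vecDegree, Finset.sup_lt_iff (lt_of_le_of_lt (Nat.zero_le _) (h j hj))]
  intro i _
  by_cases hi : w i = 0
  · rw [hi, Polynomial.natDegree_zero]
    exact lt_of_le_of_lt (Nat.zero_le _) (h j hj)
  · exact h i hi

theorem toRatVec_injective : Function.Injective (toRatVec : (Fin q → F[X]) → _) :=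
  fun _ _ h => funext fun j => IsFractionRing.injective F[X] (RatFunc F) (congrFun h j)

theorem toRatVec_zero : toRatVec (0 : Fin q → F[X]) = 0 :=
  funext fun _ => map_zero _

theorem toRatVec_smul (p : F[X]) (v : Fin q → F[X]) :
    toRatVec (p • v) = algebraMap F[X] (RatFunc F) p • toRatVec v :=
  funext fun _ => map_mul _ _ _

theorem toRatVec_vecMul (u : Fin r → F[X]) (b : Matrix (Fin r) (Fin q) F[X]) :
    toRatVec (u ᵥ* b) = ∑ i, algebraMap F[X] (RatFunc F) (u i) • toRatVec (b i) := by
  ext j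
  simp only [toRatVec, vecMul, dotProduct, map_sum, map_mul, Finset.sum_apply, Pi.smul_apply,
    smul_eq_mul]

theorem vecMul_of_apply (u : Fin r → F[X]) (b : Fin r → Fin q → F[X]) (j : Fin q) :
    (u ᵥ* Matrix.of b) j = ∑ i, u i * b i j :=
  rfl

/-- The predictable degree property. -/
theorem natDegree_add_le_vecDegree_vecMul {e : Fin r → ℕ} {b : Matrix (Fin r) (Fin q) F[X]}
    (hb : b ∈ RowDegreeBounded e) (hL : ∀ c, c ᵥ* leadingRowwiseCoeff e b = 0 → c = 0)
    (a : Fin r → F[X]) {i₀ : Fin r} (ha : a i₀ ≠ 0) :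
    (a i₀).natDegree + e i₀ ≤ vecDegree (a ᵥ* b) := by
  classical
  obtain ⟨i₁, hi₁, hmax⟩ := Finset.exists_max_image (Finset.univ.filter fun i => a i ≠ 0)
    (fun i => (a i).natDegree + e i) ⟨i₀, by simpa using ha⟩
  simp only [Finset.mem_filter, Finset.mem_univ, true_and] at hi₁ hmax
  refine (hmax i₀ ha).trans ?_
  set N := (a i₁).natDegree + e i₁ with hN
  by_contra! hlt
  -- These are the coefficients of `a` that contribute to degree `N` of `a ᵥ* b`. The guard handles
  -- truncated subtraction: maximality makes `a i = 0` when `e i > N`.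
  have hc := hL (fun i => if e i ≤ N then (a i).coeff (N - e i) else 0) ?_
  · have h1 := congrFun hc i₁
    simp only [hN, le_add_iff_nonneg_left, zero_le, if_true, add_tsub_cancel_right,
      Polynomial.coeff_natDegree, Pi.zero_apply, Polynomial.leadingCoeff_eq_zero] at h1
    exact hi₁ h1
  · ext l
    have h2 : ((a ᵥ* b) l).coeff N = 0 :=
      Polynomial.coeff_eq_zero_of_natDegree_lt
        (lt_of_le_of_lt (natDegree_le_vecDegree _ l) hlt)
    refine Eq.trans ?_ h2
    simp only [vecMul, dotProduct, Polynomial.finsetSum_coeff]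
    refine Finset.sum_congr rfl fun i _ => ?_
    by_cases hi : a i = 0
    · simp [hi]
    · have h3 := hmax i hi
      rw [if_pos (by omega)]
      have h4 := Polynomial.coeff_mul_add_eq_of_natDegree_le (f := a i) (g := b i l)
        (df := N - e i) (dg := e i) (by omega) (hb i l)
      rw [Nat.sub_add_cancel (by omega)] at h4
      exact h4.symm

theorem IsPolynomialBasis.card_eq {V : Submodule (RatFunc F) (Fin q → RatFunc F)}
    {b : Fin r → Fin q → F[X]} (h : IsPolynomialBasis V b) :
    r = Module.finrank (RatFunc F) V := by
  have := finrank_span_eq_card h.1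
  rw [h.2, Fintype.card_fin] at this
  exact this.symm

theorem isPolynomialBasis_of_span {V : Submodule (RatFunc F) (Fin q → RatFunc F)}
    {b : Fin r → Fin q → F[X]} (hr : r = Module.finrank (RatFunc F) V)
    (h : Submodule.span (RatFunc F) (Set.range fun i => toRatVec (b i)) = V) :
    IsPolynomialBasis V b := by
  refine ⟨?_, h⟩
  rw [linearIndependent_iff_card_eq_finrank_span, Set.finrank, h, Fintype.card_fin, ← hr]

/-- Steinitz exchange over the rational functions, with denominators cleared by `p`. -/
theorem IsPolynomialBasis.update {V : Submodule (RatFunc F) (Fin q → RatFunc F)}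
    {b : Fin r → Fin q → F[X]} (h : IsPolynomialBasis V b) {i₀ : Fin r} {w : Fin q → F[X]}
    {u : Fin r → F[X]} {p : F[X]} (hp : p ≠ 0) (hu : u i₀ ≠ 0)
    (hw : p • w = u ᵥ* Matrix.of b) : IsPolynomialBasis V (Function.update b i₀ w) := by
  refine isPolynomialBasis_of_span h.card_eq ?_
  have hp' : algebraMap F[X] (RatFunc F) p ≠ 0 := by
    simpa using hp
  have hu' : algebraMap F[X] (RatFunc F) (u i₀) ≠ 0 := by
    simpa using hu
  have hw' : algebraMap F[X] (RatFunc F) p • toRatVec w =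
      ∑ i, algebraMap F[X] (RatFunc F) (u i) • toRatVec (b i) := by
    rw [← toRatVec_smul, hw, toRatVec_vecMul]
    rfl
  have hbV : ∀ i, toRatVec (b i) ∈ V := fun i => h.2 ▸ Submodule.subset_span ⟨i, rfl⟩
  apply le_antisymm
  · rw [Submodule.span_le]
    rintro _ ⟨i, rfl⟩
    rcases eq_or_ne i i₀ with rfl | hi
    · simp only [Function.update_self, SetLike.mem_coe]
      rw [← V.smul_mem_iff hp', hw']
      exact V.sum_mem fun i _ => V.smul_mem _ (hbV i)
    · simp only [Function.update_of_ne hi]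
      exact hbV i
  · set W := Submodule.span (RatFunc F)
      (Set.range fun i => toRatVec (Function.update b i₀ w i)) with hW
    have hW0 : toRatVec w ∈ W := Submodule.subset_span ⟨i₀, by simp⟩
    have hWi : ∀ i ≠ i₀, toRatVec (b i) ∈ W := fun i hi =>
      Submodule.subset_span ⟨i, by simp [Function.update_of_ne hi]⟩
    rw [← h.2, Submodule.span_le]
    rintro _ ⟨i, rfl⟩
    rcases eq_or_ne i i₀ with rfl | hi
    · simp only [SetLike.mem_coe]
      rw [← W.smul_mem_iff hu']
      rw [← Finset.add_sum_erase _ _ (Finset.mem_univ i)] at hw'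
      rw [← sub_eq_of_eq_add hw']
      exact W.sub_mem (W.smul_mem _ hW0)
        (W.sum_mem fun l hl => W.smul_mem _ (hWi l (Finset.ne_of_mem_erase hl)))
    · exact hWi i hi

/-- Exchanging `b i₀` for `w` cannot lower the degree sum. -/
theorem IsMinimalBasis.exists_le_natDegree {V : Submodule (RatFunc F) (Fin q → RatFunc F)}
    {b : Fin r → Fin q → F[X]} (h : IsMinimalBasis V b) {i₀ : Fin r} {w : Fin q → F[X]}
    {u : Fin r → F[X]} {p : F[X]} (hp : p ≠ 0) (hu : u i₀ ≠ 0)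
    (hw : p • w = u ᵥ* Matrix.of b) : ∃ j, w j ≠ 0 ∧ vecDegree (b i₀) ≤ (w j).natDegree := by
  have hB := h.1.update hp hu hw
  have hw0 : w ≠ 0 := by
    rintro rfl
    refine hB.1.ne_zero i₀ ?_
    simp only [Function.update_self, toRatVec_zero]
  by_contra! hlt
  have h1 := vecDegree_lt_of_ne_zero hw0 hlt
  have h2 := h.2 _ hB
  rw [← Finset.add_sum_erase _ _ (Finset.mem_univ i₀),
    ← Finset.add_sum_erase _ (fun i => vecDegree (Function.update b i₀ w i)) (Finset.mem_univ i₀),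
    Function.update_self,
    Finset.sum_congr rfl fun i hi =>
      congrArg vecDegree (Function.update_of_ne (Finset.ne_of_mem_erase hi) w b)] at h2
  omega

theorem mem_rowDegreeBounded_vecDegree (b : Fin r → Fin q → F[X]) :
    Matrix.of b ∈ RowDegreeBounded fun i => vecDegree (b i) :=
  fun i j => natDegree_le_vecDegree (b i) j

/-- Row reducedness: a relation among leading rows, weighted by powers of `X` to equalize degrees,
would cancel the top degree and give a cheaper replacement for the highest-degree vector involved.
-/
theorem IsMinimalBasis.leading_vecMul_eq_zero {V : Submodule (RatFunc F) (Fin q → RatFunc F)}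
    {b : Fin r → Fin q → F[X]} (h : IsMinimalBasis V b) (c : Fin r → F)
    (hc : c ᵥ* leadingRowwiseCoeff (fun i => vecDegree (b i)) (Matrix.of b) = 0) : c = 0 := by
  classical
  by_contra hne
  obtain ⟨i, hi⟩ := Function.ne_iff.1 hne
  obtain ⟨i₀, hi₀, hmax⟩ := Finset.exists_max_image (Finset.univ.filter fun i => c i ≠ 0)
    (fun i => vecDegree (b i)) ⟨i, by simpa using hi⟩
  simp only [Finset.mem_filter, Finset.mem_univ, true_and] at hi₀ hmax
  let u : Fin r → F[X] := fun i =>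
    Polynomial.monomial (vecDegree (b i₀) - vecDegree (b i)) (c i)
  obtain ⟨j, hj0, hj⟩ := h.exists_le_natDegree (u := u) (i₀ := i₀) (w := u ᵥ* Matrix.of b)
    one_ne_zero (by simpa [u] using hi₀) (one_smul _ _)
  have hle : ∀ i, (u i * b i j).natDegree ≤ vecDegree (b i₀) := fun i => by
    by_cases hci : c i = 0
    · simp [u, hci]
    · have h1 := Polynomial.natDegree_mul_le (p := u i) (q := b i j)
      have h2 := Polynomial.natDegree_monomial_le (c i)
        (m := vecDegree (b i₀) - vecDegree (b i))
      have h3 := natDegree_le_vecDegree (b i) j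
      have h4 := hmax i hci
      simp only [u] at h1 ⊢
      omega
  have hdeg : ((u ᵥ* Matrix.of b) j).natDegree ≤ vecDegree (b i₀) := by
    rw [vecMul_of_apply]
    exact Polynomial.natDegree_sum_le_of_forall_le _ _ fun i _ => hle i
  apply hj0
  rw [← Polynomial.leadingCoeff_eq_zero, Polynomial.leadingCoeff, le_antisymm hdeg hj]
  refine Eq.trans ?_ (congrFun hc j)
  simp only [vecMul, dotProduct, Polynomial.finsetSum_coeff]
  refine Finset.sum_congr rfl fun i _ => ?_
  by_cases hci : c i = 0
  · simp [u, hci]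
  · have h4 := hmax i hci
    have h5 := Polynomial.coeff_mul_add_eq_of_natDegree_le (f := u i) (g := b i j)
      (Polynomial.natDegree_monomial_le (c i)) (natDegree_le_vecDegree (b i) j)
    rw [Nat.sub_add_cancel h4] at h5
    refine h5.trans ?_
    simp only [u, Polynomial.coeff_monomial_same]
    rfl

/-- A polynomial matrix that is not right invertible has, modulo a nonzero polynomial `p`, a
nontrivial left null vector. -/
theorem exists_vecMul_eq_smul_of_not_surjective (B : Matrix (Fin r) (Fin q) F[X])
    (hB : ¬ Function.Surjective B.mulVec) :
    ∃ (p : F[X]) (u : Fin r → F[X]) (w : Fin q → F[X]), p ≠ 0 ∧ u ≠ 0 ∧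
      (∀ i, (u i).degree < p.degree) ∧ p • w = u ᵥ* B := by
  rw [← coe_mulVecLin, ← LinearMap.range_eq_top] at hB
  -- A proper range lies in a maximal submodule, so some nonzero functional into a residue field
  -- `F[X] ⧸ I` kills it; a generator of `I` is the required `p`.
  obtain ⟨N, hN, hle⟩ := (eq_top_or_exists_le_coatom _).resolve_left hB
  have hs : IsSimpleModule F[X] ((Fin r → F[X]) ⧸ N) := isSimpleModule_iff_isCoatom.2 hN
  obtain ⟨I, hI, ⟨e⟩⟩ := isSimpleModule_iff_quot_maximal.1 hs
  let f : (Fin r → F[X]) →ₗ[F[X]] F[X] ⧸ I := e.toLinearMap ∘ₗ N.mkQ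
  have hf0 : ∀ x, f (B *ᵥ x) = 0 := fun x => by
    have : N.mkQ (B *ᵥ x) = 0 := by
      rw [Submodule.mkQ_apply, Submodule.Quotient.mk_eq_zero]
      exact hle ⟨x, rfl⟩
    simp only [f, LinearMap.comp_apply, this, map_zero]
  have hfs : Function.Surjective f := e.surjective.comp N.mkQ_surjective
  obtain ⟨p, hp⟩ := (IsPrincipalIdealRing.principal I).principal
  have hp0 : p ≠ 0 := by
    rintro rfl
    have := Ring.ne_bot_of_isMaximal_of_not_isField hI (Polynomial.not_isField F)
    apply this
    rw [hp]
    simp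
  choose u₀ hu₀ using fun i : Fin r => Ideal.Quotient.mk_surjective (f (Pi.single i 1))
  have hmem : ∀ x : F[X], Ideal.Quotient.mk I x = 0 ↔ p ∣ x := fun x => by
    rw [Ideal.Quotient.eq_zero_iff_mem, hp]
    exact Ideal.mem_span_singleton
  -- Remainders represent the same functional and supply the bound `deg u < deg p`.
  have hu : ∀ i, Ideal.Quotient.mk I (u₀ i % p) = f (Pi.single i 1) := fun i => by
    rw [← hu₀, ← sub_eq_zero, ← map_sub, hmem, EuclideanDomain.mod_eq_sub_mul_div]
    exact ⟨-(u₀ i / p), by ring⟩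
  have hfx : ∀ x, f x = Ideal.Quotient.mk I (∑ i, (u₀ i % p) * x i) := fun x => by
    conv_lhs => rw [pi_eq_sum_univ' x]
    rw [map_sum, map_sum]
    refine Finset.sum_congr rfl fun i _ => ?_
    rw [map_smul, ← hu i, mul_comm]
    rfl
  have hdvd : ∀ j, p ∣ ((fun i => u₀ i % p) ᵥ* B) j := fun j => by
    have h1 := hf0 (Pi.single j 1)
    rw [hfx, hmem] at h1
    simpa [vecMul, dotProduct] using h1
  choose w hw using hdvd
  refine ⟨p, fun i => u₀ i % p, w, hp0, fun h0 => ?_, fun i => ?_, ?_⟩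
  · obtain ⟨x, hx⟩ := hfs 1
    rw [hfx] at hx
    have h2 : ∀ i, u₀ i % p = 0 := fun i => congrFun h0 i
    simp only [h2, zero_mul, Finset.sum_const_zero, map_zero] at hx
    have : Nontrivial (F[X] ⧸ I) := Ideal.Quotient.nontrivial_iff.2 hI.ne_top
    exact zero_ne_one hx
  · exact EuclideanDomain.mod_lt _ hp0
  · ext1 j
    exact (hw j).symm

/-- Otherwise `p • w = u ᵥ* b` with `deg u < deg p`, so `w` has smaller degree than the
highest-degree vector used and could replace it. -/
theorem IsMinimalBasis.mulVec_surjective {V : Submodule (RatFunc F) (Fin q → RatFunc F)}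
    {b : Fin r → Fin q → F[X]} (h : IsMinimalBasis V b) :
    Function.Surjective (Matrix.of b).mulVec := by
  classical
  by_contra hB
  obtain ⟨p, u, w, hp, hu, hdeg, hw⟩ := exists_vecMul_eq_smul_of_not_surjective _ hB
  obtain ⟨i, hi⟩ := Function.ne_iff.1 hu
  obtain ⟨i₀, hi₀, hmax⟩ := Finset.exists_max_image (Finset.univ.filter fun i => u i ≠ 0)
    (fun i => vecDegree (b i)) ⟨i, by simpa using hi⟩
  simp only [Finset.mem_filter, Finset.mem_univ, true_and] at hi₀ hmax
  obtain ⟨j, hj0, hj⟩ := h.exists_le_natDegree hp hi₀ hw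
  have h1 : ((u ᵥ* Matrix.of b) j).degree <
      (p.natDegree + vecDegree (b i₀) : ℕ) := by
    rw [vecMul_of_apply]
    refine lt_of_le_of_lt (Polynomial.degree_sum_le _ _) ?_
    rw [Finset.sup_lt_iff (WithBot.bot_lt_coe _)]
    intro i _
    by_cases hui : u i = 0
    · simp only [hui, zero_mul, Polynomial.degree_zero]
      exact WithBot.bot_lt_coe _
    · refine lt_of_le_of_lt Polynomial.degree_le_natDegree ?_
      have h2 := Polynomial.natDegree_mul_le (p := u i) (q := b i j)
      have h3 := Polynomial.natDegree_lt_natDegree hui (hdeg i)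
      have h4 := natDegree_le_vecDegree (b i) j
      have h5 := hmax i hui
      exact_mod_cast (by omega)
  rw [← hw, Pi.smul_apply, smul_eq_mul,
    Polynomial.degree_eq_natDegree (mul_ne_zero hp hj0), Polynomial.natDegree_mul hp hj0] at h1
  have h6 : p.natDegree + (w j).natDegree < p.natDegree + vecDegree (b i₀) := by exact_mod_cast h1
  omega

theorem vecMul_eq_zero_of_mulVec_surjective {R : Type*} [CommRing R]
    {A : Matrix (Fin r) (Fin q) R} (hA : Function.Surjective A.mulVec) (c : Fin r → R)
    (hc : c ᵥ* A = 0) : c = 0 := by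
  refine dotProduct_eq_zero c fun y => ?_
  obtain ⟨x, rfl⟩ := hA y
  rw [dotProduct_mulVec, hc, zero_dotProduct]

theorem exists_mul_eq_one_of_mulVec_surjective {R : Type*} [CommRing R]
    {A : Matrix (Fin r) (Fin q) R} (hA : Function.Surjective A.mulVec) :
    ∃ B : Matrix (Fin q) (Fin r) R, A * B = 1 := by
  choose x hx using fun i : Fin r => hA (Pi.single i 1)
  refine ⟨(Matrix.of x)ᵀ, ?_⟩
  ext i j
  have := congrFun (hx j) i
  simp only [Matrix.one_apply]
  rw [Pi.single_apply] at this
  exact this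

theorem mulVec_surjective_of_mul_eq_one {R : Type*} [CommRing R]
    {A : Matrix (Fin r) (Fin q) R} {B : Matrix (Fin q) (Fin r) R} (h : A * B = 1) :
    Function.Surjective A.mulVec :=
  fun y => ⟨B *ᵥ y, by rw [mulVec_mulVec, h, one_mulVec]⟩

theorem map_mulVec_surjective {M : Matrix (Fin r) (Fin q) F[X]}
    (hM : Function.Surjective M.mulVec) :
    Function.Surjective (M.map (algebraMap F[X] (RatFunc F))).mulVec := by
  obtain ⟨B, hB⟩ := exists_mul_eq_one_of_mulVec_surjective hM
  refine mulVec_surjective_of_mul_eq_one (B := B.map (algebraMap F[X] (RatFunc F))) ?_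
  rw [← Matrix.map_mul, hB]
  simp

theorem linearIndependent_toRatVec {M : Matrix (Fin r) (Fin q) F[X]}
    (hM : Function.Surjective M.mulVec) :
    LinearIndependent (RatFunc F) fun i => toRatVec (M i) := by
  rw [Fintype.linearIndependent_iff]
  intro g hg i
  refine congrFun (vecMul_eq_zero_of_mulVec_surjective (map_mulVec_surjective hM) g ?_) i
  rw [vecMul_eq_sum]
  exact hg

/-- Polynomial vectors in the row space of a right invertible polynomial matrix are polynomial
combinations of its rows. -/
theorem exists_vecMul_eq_of_mem_span {M : Matrix (Fin r) (Fin q) F[X]}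
    (hM : Function.Surjective M.mulVec) {v : Fin q → F[X]}
    (hv : toRatVec v ∈
      Submodule.span (RatFunc F) (Set.range fun i => toRatVec (M i))) :
    ∃ a : Fin r → F[X], a ᵥ* M = v := by
  obtain ⟨B, hB⟩ := exists_mul_eq_one_of_mulVec_surjective hM
  obtain ⟨α, hα⟩ := (Submodule.mem_span_range_iff_exists_fun _).1 hv
  have h1 : α ᵥ* M.map (algebraMap F[X] (RatFunc F)) = toRatVec v := by
    rw [vecMul_eq_sum]
    exact hα
  -- A polynomial right inverse recovers the rational coordinates, so they are polynomial.
  have h2 : toRatVec (v ᵥ* B) = α := by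
    have h3 : toRatVec (v ᵥ* B) = toRatVec v ᵥ* B.map (algebraMap F[X] (RatFunc F)) := by
      ext j
      simp [toRatVec, vecMul, dotProduct]
    rw [h3, ← h1, vecMul_vecMul, ← Matrix.map_mul, hB]
    simp
  refine ⟨v ᵥ* B, toRatVec_injective ?_⟩
  rw [toRatVec_vecMul, ← hα]
  refine Finset.sum_congr rfl fun i _ => ?_
  rw [← congrFun h2 i]
  rfl

/-- Any competing basis is `A M` with `A` polynomial and nonsingular. A nonzero Leibniz term of `det
A` pairs each row of `M` with a competitor of at least its degree, by the predictable degree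
property. -/
theorem rowsMinimalBasis_of_surjective {e : Fin r → ℕ} {M : Matrix (Fin r) (Fin q) F[X]}
    (hM : M ∈ RowDegreeBounded e)
    (hL : Function.Surjective (leadingRowwiseCoeff e M).mulVec)
    (hS : Function.Surjective M.mulVec) : RowsMinimalBasis M := by
  refine ⟨⟨linearIndependent_toRatVec hS, rfl⟩, fun c hc => ?_⟩
  have h1 : ∀ i, ∃ a : Fin r → F[X], a ᵥ* M = c i := fun i =>
    exists_vecMul_eq_of_mem_span hS (hc.2 ▸ Submodule.subset_span ⟨i, rfl⟩)
  choose A hA using h1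
  have hdet : (Matrix.of A).det ≠ 0 := by
    intro h0
    obtain ⟨v, hv, hvA⟩ := Matrix.exists_vecMul_eq_zero_iff.2 h0
    have h2 : v ᵥ* Matrix.of c = 0 := by
      have h3 : Matrix.of c = Matrix.of A * M := by
        ext i j
        exact (congrArg (fun p => Polynomial.coeff p _) (congrFun (hA i) j)).symm
      rw [h3, ← vecMul_vecMul, hvA, zero_vecMul]
    have h4 := toRatVec_vecMul v (Matrix.of c)
    rw [h2, toRatVec_zero] at h4
    have h5 := Fintype.linearIndependent_iff.1 hc.1 _ h4.symm
    exact hv (funext fun i => by simpa using h5 i)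
  rw [Matrix.det_apply] at hdet
  simp only [Matrix.of_apply] at hdet
  obtain ⟨σ, -, hσ⟩ := Finset.exists_ne_zero_of_sum_ne_zero hdet
  have hσ' : ∀ i, A (σ i) i ≠ 0 := fun i h0 =>
    hσ (by rw [Finset.prod_eq_zero (f := fun i => A (σ i) i) (Finset.mem_univ i) h0, smul_zero])
  calc ∑ i, vecDegree (M i) ≤ ∑ i, vecDegree (c (σ i)) := by
        refine Finset.sum_le_sum fun i _ => ?_
        have h6 := natDegree_add_le_vecDegree_vecMul hM
          (vecMul_eq_zero_of_mulVec_surjective hL) (A (σ i)) (hσ' i)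
        rw [hA] at h6
        exact (vecDegree_le (hM i)).trans (le_trans (Nat.le_add_left _ _) h6)
    _ = ∑ i, vecDegree (c i) := Equiv.sum_comp σ fun i => vecDegree (c i)

/-- A common denominator is cleared from a rational basis. -/
theorem exists_isPolynomialBasis (V : Submodule (RatFunc F) (Fin q → RatFunc F)) :
    ∃ b : Fin (Module.finrank (RatFunc F) V) → Fin q → F[X], IsPolynomialBasis V b := by
  let v := Module.finBasis (RatFunc F) V
  obtain ⟨s, hs⟩ := IsLocalization.exist_integer_multiples_of_finite (nonZeroDivisors F[X])
    fun ij : Fin (Module.finrank (RatFunc F) V) × Fin q => (v ij.1 : Fin q → RatFunc F) ij.2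
  choose p hp using hs
  have hs0 : algebraMap F[X] (RatFunc F) s ≠ 0 := by
    simp
  have hpv : ∀ i, toRatVec (fun j => p (i, j)) =
      algebraMap F[X] (RatFunc F) s • (v i : Fin q → RatFunc F) := fun i => by
    ext j
    rw [Pi.smul_apply, smul_eq_mul, ← Algebra.smul_def]
    exact hp (i, j)
  refine ⟨fun i j => p (i, j), isPolynomialBasis_of_span rfl (le_antisymm ?_ ?_)⟩
  · rw [Submodule.span_le]
    rintro _ ⟨i, rfl⟩
    simp only [hpv, SetLike.mem_coe]
    exact V.smul_mem _ (v i).2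
  · intro x hx
    have h1 := v.sum_repr ⟨x, hx⟩
    have h2 : x = ∑ i, v.repr ⟨x, hx⟩ i • (v i : Fin q → RatFunc F) := by
      have h3 := congrArg V.subtype h1
      rw [map_sum] at h3
      exact h3.symm
    rw [h2]
    refine Submodule.sum_mem _ fun i _ => Submodule.smul_mem _ _ ?_
    rw [← Submodule.smul_mem_iff _ hs0, ← hpv]
    exact Submodule.subset_span ⟨i, rfl⟩

theorem exists_isMinimalBasis (V : Submodule (RatFunc F) (Fin q → RatFunc F)) :
    ∃ b : Fin (Module.finrank (RatFunc F) V) → Fin q → F[X], IsMinimalBasis V b := by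
  classical
  have h : ∃ s, ∃ b : Fin (Module.finrank (RatFunc F) V) → Fin q → F[X],
      IsPolynomialBasis V b ∧ ∑ i, vecDegree (b i) = s := by
    obtain ⟨b, hb⟩ := exists_isPolynomialBasis V
    exact ⟨_, b, hb, rfl⟩
  obtain ⟨b, hb, hs⟩ := Nat.find_spec h
  exact ⟨b, hb, fun c hc => hs.trans_le (Nat.find_min' h ⟨c, hc, rfl⟩)⟩

end MinimalBases

/-! ### Right minimal indices and the least full-rank index -/

section NullSpace

variable {F : Type*} [Field F] {m q r : ℕ}

theorem toRatVec_mem_rightNullSpace_iff (M : Matrix (Fin m) (Fin q) F[X]) (x : Fin q → F[X]) :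
    toRatVec x ∈ rightNullSpace M ↔ M *ᵥ x = 0 := by
  have h : M.map (algebraMap F[X] (RatFunc F)) *ᵥ toRatVec x = toRatVec (M *ᵥ x) := by
    ext i
    simp [toRatVec, mulVec, dotProduct]
  rw [rightNullSpace, LinearMap.mem_ker, mulVecLin_apply, h, ← toRatVec_zero,
    toRatVec_injective.eq_iff]

theorem finrank_ker_mulVecLin {K : Type*} [Field K] {n : ℕ} {A : Matrix (Fin m) (Fin (m + n)) K}
    (hA : Function.Surjective A.mulVec) :
    Module.finrank K (LinearMap.ker A.mulVecLin) = n := by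
  have h1 := LinearMap.finrank_range_add_finrank_ker A.mulVecLin
  rw [LinearMap.range_eq_top.2 hA, finrank_top, Module.finrank_fin_fun,
    Module.finrank_fin_fun] at h1
  omega

/-- The minimal indices of the right null space are bounded by every `k` for which the `k`-th
trimmed Sylvester matrix has full row rank. -/
theorem SylvesterSurjective.vecDegree_le {d : Fin m → ℕ} {M : Matrix (Fin m) (Fin q) F[X]}
    (hM : M ∈ RowDegreeBounded d) {k : ℕ} (h : SylvesterSurjective d k M)
    {b : Fin r → Fin q → F[X]} (hb : IsMinimalBasis (rightNullSpace M) b) (i₀ : Fin r) :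
    vecDegree (b i₀) ≤ k := by
  by_contra! hk
  -- Pairing with `y` extracts the `i₀`-th coordinate in the basis `b`. It vanishes on null vectors
  -- of degree `≤ k` by predictable degrees, and induction on degree extends this to all null
  -- vectors, contradicting `b i₀ ⬝ᵥ y = 1`.
  obtain ⟨y, hy⟩ := hb.mulVec_surjective (Pi.single i₀ 1)
  have hbase : ∀ x : Fin q → F[X], (∀ j t, k < t → (x j).coeff t = 0) → M *ᵥ x = 0 →
      x ⬝ᵥ y = 0 := by
    intro x hx hMx
    have hspan := (toRatVec_mem_rightNullSpace_iff M x).2 hMx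
    rw [← hb.1.2] at hspan
    obtain ⟨a, rfl⟩ := exists_vecMul_eq_of_mem_span hb.mulVec_surjective hspan
    rw [← dotProduct_mulVec, hy, dotProduct_single, mul_one]
    by_contra ha
    have h1 := natDegree_add_le_vecDegree_vecMul (mem_rowDegreeBounded_vecDegree b)
      hb.leading_vecMul_eq_zero a ha
    have h2 := TrimmedSylvester.vecDegree_le fun j =>
      Polynomial.natDegree_le_iff_coeff_eq_zero.2 (hx j)
    omega
  have hall : ∀ N, k ≤ N → ∀ x : Fin q → F[X], (∀ j t, N < t → (x j).coeff t = 0) →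
      M *ᵥ x = 0 → x ⬝ᵥ y = 0 := by
    intro N hN
    induction N, hN using Nat.le_induction with
    | base => exact hbase
    | succ N hN ih =>
      intro x hx hMx
      -- The top coefficient of `x` lies in the kernel of the leading matrix, so `M *ᵥ w` loses its
      -- top term and equals `M *ᵥ z` with `deg z < k`. The null vector `w - z`, shifted, then
      -- cancels the top of `x`.
      set w : Fin q → F[X] := fun j => Polynomial.monomial k ((x j).coeff (N + 1)) with hw
      have hwdeg : ∀ j t, k < t → (w j).coeff t = 0 := fun j t ht =>
        Polynomial.coeff_monomial_of_ne _ (by omega)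
      obtain ⟨z, hz, hMz⟩ := h (M *ᵥ w) fun i t ht => by
        rcases ht.eq_or_lt with rfl | ht
        · rw [coeff_mulVec_top hM hwdeg]
          have h1 := coeff_mulVec_top hM hx i
          rw [hMx, Pi.zero_apply, Polynomial.coeff_zero] at h1
          simp only [hw, Polynomial.coeff_monomial_same]
          exact h1.symm
        · exact coeff_mulVec_eq_zero hM (N := k + 1) (fun j t ht => hwdeg j t ht) i (by omega)
      have hv0 : M *ᵥ (w - z) = 0 := by rw [mulVec_sub, hMz, sub_self]
      have hv : (w - z) ⬝ᵥ y = 0 := hbase _ (fun j t ht => by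
        rw [Pi.sub_apply, Polynomial.coeff_sub, hwdeg j t ht, hz j t ht.le, sub_zero]) hv0
      have hx' := ih (x - (Polynomial.X ^ (N + 1 - k) : F[X]) • (w - z)) (fun j t ht => by
        simp only [Pi.sub_apply, Pi.smul_apply, smul_eq_mul, Polynomial.coeff_sub,
          Polynomial.coeff_X_pow_mul']
        rw [if_pos (by omega), hz j _ (by omega), sub_zero]
        rcases (Nat.succ_le_of_lt ht).eq_or_lt with rfl | ht'
        · rw [hw, Nat.succ_eq_add_one, Nat.sub_sub_self (by omega),
            Polynomial.coeff_monomial_same, sub_self]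
        · rw [hx j t ht', hwdeg j _ (by omega), sub_zero])
        (by rw [mulVec_sub, mulVec_smul, hv0, hMx, smul_zero, sub_zero])
      rw [sub_dotProduct, smul_dotProduct, hv, smul_zero, sub_zero] at hx'
      exact hx'
  have h3 : b i₀ ⬝ᵥ y = 0 := by
    refine hall (vecDegree (b i₀)) hk.le _ (fun j t ht =>
      Polynomial.coeff_eq_zero_of_natDegree_lt
        (lt_of_le_of_lt (natDegree_le_vecDegree _ j) ht)) ?_
    rw [← toRatVec_mem_rightNullSpace_iff, ← hb.1.2]
    exact Submodule.subset_span ⟨i₀, rfl⟩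
  have h4 := congrFun hy i₀
  rw [Pi.single_eq_same] at h4
  exact zero_ne_one (h3.symm.trans h4)

/-- If all right minimal indices are at most `k`, then full row rank descends from `k + 1` to
`k`. -/
theorem SylvesterSurjective.of_succ {n : ℕ} {d : Fin m → ℕ}
    {M : Matrix (Fin m) (Fin (m + n)) F[X]} (hM : M ∈ RowDegreeBounded d)
    (hL : Function.Surjective (leadingRowwiseCoeff d M).mulVec)
    (hS : Function.Surjective M.mulVec) {b : Fin r → Fin (m + n) → F[X]}
    (hb : IsMinimalBasis (rightNullSpace M) b) {k : ℕ} (hk : ∀ i, vecDegree (b i) ≤ k)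
    (h : SylvesterSurjective d (k + 1) M) : SylvesterSurjective d k M := by
  set e : Fin r → ℕ := fun i => vecDegree (b i)
  have hr : r = n := by
    rw [hb.1.card_eq]
    exact finrank_ker_mulVecLin (map_mulVec_surjective hS)
  have hMb : ∀ i, M *ᵥ b i = 0 := fun i => by
    rw [← toRatVec_mem_rightNullSpace_iff, ← hb.1.2]
    exact Submodule.subset_span ⟨i, rfl⟩
  set B := leadingRowwiseCoeff e (Matrix.of b)
  have hBker : ∀ i, leadingRowwiseCoeff d M *ᵥ B i = 0 := fun i => by
    ext l
    have h1 := coeff_mulVec_top hM (N := e i) (x := b i) (fun j t ht =>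
      Polynomial.coeff_eq_zero_of_natDegree_lt
        (lt_of_le_of_lt (natDegree_le_vecDegree _ j) ht)) l
    rw [hMb, Pi.zero_apply, Polynomial.coeff_zero] at h1
    exact h1.symm
  have hBli : LinearIndependent F fun i => B i := by
    rw [Fintype.linearIndependent_iff]
    intro g hg i
    refine congrFun (hb.leading_vecMul_eq_zero g ?_) i
    rw [vecMul_eq_sum]
    exact hg
  -- The leading rows of `b` are independent and lie in this kernel; both spaces have dimension `n`.
  have hspan : Submodule.span F (Set.range fun i => B i) =
      LinearMap.ker (leadingRowwiseCoeff d M).mulVecLin := by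
    refine Submodule.eq_of_le_of_finrank_eq ?_ ?_
    · rw [Submodule.span_le]
      rintro _ ⟨i, rfl⟩
      exact hBker i
    · rw [finrank_span_eq_card hBli, finrank_ker_mulVecLin hL, Fintype.card_fin, hr]
  intro y hy
  obtain ⟨x, hx, hxy⟩ := h y fun i t ht => hy i t (by omega)
  have hker : (fun j => (x j).coeff k) ∈
      LinearMap.ker (leadingRowwiseCoeff d M).mulVecLin := by
    rw [LinearMap.mem_ker, mulVecLin_apply]
    ext i
    rw [← coeff_mulVec_top hM (fun j t ht => hx j t ht) i, hxy, hy i _ le_rfl, Pi.zero_apply]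
  rw [← hspan, Submodule.mem_span_range_iff_exists_fun] at hker
  obtain ⟨c, hc⟩ := hker
  -- The degree-`k` coefficient of `x` is a combination of leading rows of `b`; the shifts to degree
  -- `k` exist because `e i ≤ k`.
  refine ⟨x - ∑ i, (Polynomial.monomial (k - e i) (c i)) • b i, fun j t ht => ?_, ?_⟩
  · have h2 : ∀ i, ((Polynomial.monomial (k - e i) (c i)) * b i j).natDegree ≤ k := fun i => by
      refine Polynomial.natDegree_mul_le.trans ?_
      have h3 := Polynomial.natDegree_monomial_le (c i) (m := k - e i)
      have h4 : (b i j).natDegree ≤ e i := natDegree_le_vecDegree (b i) j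
      have h5 : e i ≤ k := hk i
      omega
    simp only [Pi.sub_apply, Finset.sum_apply, Pi.smul_apply, smul_eq_mul,
      Polynomial.coeff_sub, Polynomial.finsetSum_coeff]
    rcases ht.eq_or_lt with rfl | ht
    · rw [sub_eq_zero, ← congrFun hc j, Finset.sum_apply]
      refine Finset.sum_congr rfl fun i _ => ?_
      have h6 := Polynomial.coeff_mul_add_eq_of_natDegree_le
        (Polynomial.natDegree_monomial_le (c i) (m := k - e i))
        (natDegree_le_vecDegree (b i) j)
      rw [Nat.sub_add_cancel (hk i), Polynomial.coeff_monomial_same] at h6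
      exact h6.symm
    · rw [hx j t ht, Finset.sum_eq_zero, sub_zero]
      exact fun i _ => Polynomial.coeff_eq_zero_of_natDegree_lt (lt_of_le_of_lt (h2 i) ht)
  · rw [mulVec_sub, mulVec_sum, hxy]
    simp only [mulVec_smul, hMb, smul_zero, Finset.sum_const_zero, sub_zero]

/-- At `k = 0` the source is zero, but the target contains a nonzero constant where `d i > 0`. -/
theorem not_sylvesterSurjective_zero {d : Fin m → ℕ} (hd : 0 < Finset.univ.sup d)
    (M : Matrix (Fin m) (Fin q) F[X]) : ¬ SylvesterSurjective d 0 M := by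
  intro h
  obtain ⟨i, -, hi⟩ := (Finset.lt_sup_iff).1 hd
  obtain ⟨x, hx, hxy⟩ := h (Pi.single i 1) fun j t ht => by
    rcases eq_or_ne j i with rfl | hj
    · rw [Pi.single_eq_same, Polynomial.coeff_one, if_neg (by omega)]
    · rw [Pi.single_eq_of_ne hj, Polynomial.coeff_zero]
  have hx0 : x = 0 := by
    ext j t
    exact hx j t (Nat.zero_le t)
  have := congrFun hxy i
  rw [hx0, mulVec_zero, Pi.single_eq_same] at this
  exact zero_ne_one this

theorem isGreatest_of_isLeast {n : ℕ} {d : Fin m → ℕ} (hd : 0 < Finset.univ.sup d)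
    {M : Matrix (Fin m) (Fin (m + n)) F[X]} (hM : M ∈ RowDegreeBounded d) {d' : ℕ}
    (h : IsLeast {k : ℕ | 1 ≤ k ∧ SylvesterSurjective d k M} d') {ε : Multiset ℕ}
    (hε : IsRightMinimalIndices M ε) : IsGreatest {e : ℕ | e ∈ ε} d' := by
  obtain ⟨r, b, hb, rfl⟩ := hε
  obtain ⟨⟨h1, hs⟩, hmin⟩ := h
  have hle := hs.vecDegree_le hM hb
  constructor
  · by_contra hne
    have hlt : ∀ i, vecDegree (b i) ≤ d' - 1 := fun i => by
      have : vecDegree (b i) ≠ d' := fun H =>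
        hne (Multiset.mem_map.2 ⟨i, Finset.mem_univ_val i, H⟩)
      have := hle i
      omega
    have hpred : SylvesterSurjective d (d' - 1) M :=
      SylvesterSurjective.of_succ hM (hs.leading hM h1) (hs.mulVec_surjective h1) hb hlt
        (by rwa [Nat.sub_add_cancel h1])
    -- Leastness only concerns `k ≥ 1`, so descent to `0` is excluded separately.
    rcases Nat.eq_zero_or_pos (d' - 1) with h0 | h0
    · rw [h0] at hpred
      exact not_sylvesterSurjective_zero hd M hpred
    · have := hmin ⟨h0, hpred⟩
      omega
  · intro e he
    rw [Set.mem_ofPred_eq, Multiset.mem_map] at he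
    obtain ⟨i, -, rfl⟩ := he
    exact hle i

end NullSpace

end TrimmedSylvester

theorem mainTheorem3 {F : Type*} [Field F] (m n : ℕ) (hm : 0 < m) (hn : 0 < n)
    (d : Fin m → ℕ) (hd : 0 < Finset.univ.sup d)
    (M : Matrix (Fin m) (Fin (m + n)) (Polynomial F))
    (hM : M ∈ TrimmedSylvester.RowDegreeBounded d) :
    ((TrimmedSylvester.RowsMinimalBasis M ∧
        (TrimmedSylvester.leadingRowwiseCoeff d M).rank = m) ↔
      ∃ k : ℕ, 1 ≤ k ∧
        TrimmedSylvester.FullRowRank (TrimmedSylvester.trimmedSylvester d k M)) ∧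
    ∀ d' : ℕ,
      IsLeast {k : ℕ | 1 ≤ k ∧
        TrimmedSylvester.FullRowRank (TrimmedSylvester.trimmedSylvester d k M)} d' →
      (∃ ε : Multiset ℕ, TrimmedSylvester.IsRightMinimalIndices M ε) ∧
      (∀ ε : Multiset ℕ, TrimmedSylvester.IsRightMinimalIndices M ε →
        IsGreatest {e : ℕ | e ∈ ε} d') ∧
      ∀ k : ℕ, d' < k →
        TrimmedSylvester.FullRowRank (TrimmedSylvester.trimmedSylvester d k M) := by
  simp only [TrimmedSylvester.fullRowRank_trimmedSylvester_iff hM]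
  have hrank := TrimmedSylvester.rank_eq_card_iff_mulVec_surjective
    (TrimmedSylvester.leadingRowwiseCoeff d M)
  rw [Fintype.card_fin] at hrank
  rw [hrank]
  refine ⟨⟨fun ⟨hb, hL⟩ => TrimmedSylvester.exists_sylvesterSurjective hM hL
    hb.mulVec_surjective, fun ⟨k, hk, hs⟩ => ⟨?_, hs.leading hM hk⟩⟩, fun d' h => ⟨?_, ?_, ?_⟩⟩
  · exact TrimmedSylvester.rowsMinimalBasis_of_surjective hM (hs.leading hM hk)
      (hs.mulVec_surjective hk)
  · obtain ⟨b, hb⟩ :=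
      TrimmedSylvester.exists_isMinimalBasis (TrimmedSylvester.rightNullSpace M)
    exact ⟨_, _, b, hb, rfl⟩
  · exact fun ε hε => TrimmedSylvester.isGreatest_of_isLeast hd hM h hε
  · exact fun k hk => h.1.2.mono hM (h.1.2.leading hM h.1.1) hk.le
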